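/- A group $G$ is \emph{balanced} if for all $g,h\in G$ with $h$ of infinite order and all $k,l\in\mathbb Z\setminus\{0\}$, the equation $gh^kg^{-1}=h^l$ implies $|k|=|l|$. Let $\mathcal G=(\Gamma,(G_v)_{v\in V},(G_e)_{e\in E},(\varphi_e)_{e\in E})$ be a graph of groups on a nonempty connected graph $\Gamma$ (a graph in the sense of Serre, with oriented edges and a fixed-point-free edge inversion $e\mapsto\bar e$; $G_e=G_{\bar e}$, and each $\varphi_e$ is a monomorphism from $G_e$ to the group of an endpoint of $e$). Let $G=\pi_1(\mathcal G)$ be its fundamental group (with respect to any maximal tree of $\Gamma$) and let $T$ be its Bass--Serre tree, with the natural action of $G$. Suppose that: (a) for every $v\in V$, the vertex group $G_v$ is balanced; and (b) the action of $G$ on $T$ is \emph{Sela-acylindrical}, that is, there exists $k\ge 0$ such that for every nontrivial element $h\in G$ that is elliptic (fixes a vertex of $T$), the fixed-point set $T^{\langle h\rangle}$ has diameter at most $k$. Then $G$ is balanced. -/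

import Mathlib

universe u₁ u₂ u₃ u₄

/-- A group `G` is balanced if for all `g h : G` with `h` of infinite order and all nonzero
integers `k`, `l`, the equation `g h ^ k g⁻¹ = h ^ l` implies `|k| = |l|`. -/
def IsBalanced (G : Type*) [Group G] : Prop :=
  ∀ g h : G, ¬ IsOfFinOrder h →
    ∀ k l : ℤ, k ≠ 0 → l ≠ 0 → g * h ^ k * g⁻¹ = h ^ l → |k| = |l|

/-- A graph in the sense of Serre: vertices, oriented edges, the initial vertex map `src` and a
fixed-point-free involution `inv` of the edges. -/
structure SerreGraph where
  V : Type u₁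
  E : Type u₂
  src : E → V
  inv : E → E
  inv_inv : ∀ e, inv (inv e) = e
  inv_ne : ∀ e, inv e ≠ e

namespace SerreGraph

/-- The terminal vertex of an edge. -/
def tgt (Γ : SerreGraph.{u₁, u₂}) (e : Γ.E) : Γ.V := Γ.src (Γ.inv e)

/-- `Γ.IsPath a l b`: the finite (possibly empty) sequence of edges `l` is a path from `a`
to `b`. -/
def IsPath (Γ : SerreGraph.{u₁, u₂}) : Γ.V → List Γ.E → Γ.V → Prop
  | a, [], b => a = b
  | a, e :: l, b => Γ.src e = a ∧ Γ.IsPath (Γ.tgt e) l b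

/-- A sequence of edges has backtracking if some edge in it is followed by its inverse. -/
def HasBacktracking (Γ : SerreGraph.{u₁, u₂}) (l : List Γ.E) : Prop :=
  ∃ (l₁ l₂ : List Γ.E) (e : Γ.E), l = l₁ ++ e :: Γ.inv e :: l₂

/-- Any two vertices are joined by a path. -/
def IsConnected (Γ : SerreGraph.{u₁, u₂}) : Prop :=
  ∀ a b : Γ.V, ∃ l, Γ.IsPath a l b

/-- At most one edge from any vertex to any vertex. -/
def IsSimplicial (Γ : SerreGraph.{u₁, u₂}) : Prop :=
  ∀ e f : Γ.E, Γ.src e = Γ.src f → Γ.tgt e = Γ.tgt f → e = f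

/-- A tree: a nonempty connected simplicial graph in which every closed path is constant or has
backtracking. -/
structure IsTree (Γ : SerreGraph.{u₁, u₂}) : Prop where
  nonempty : Nonempty Γ.V
  connected : Γ.IsConnected
  simplicial : Γ.IsSimplicial
  closed_path : ∀ (a : Γ.V) (l : List Γ.E), Γ.IsPath a l a → l = [] ∨ Γ.HasBacktracking l

/-- The subgraph with all the vertices and with an inversion-invariant set `S` of edges. -/
def spanningSubgraph (Γ : SerreGraph.{u₁, u₂}) (S : Set Γ.E)
    (hS : ∀ e ∈ S, Γ.inv e ∈ S) : SerreGraph.{u₁, u₂} where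
  V := Γ.V
  E := S
  src e := Γ.src e
  inv e := ⟨Γ.inv e, hS e e.2⟩
  inv_inv e := Subtype.ext (Γ.inv_inv e)
  inv_ne e h := Γ.inv_ne e (congrArg Subtype.val h)

/-- A maximal (that is, spanning) tree of `Γ`. One exists exactly when `Γ` is nonempty and
connected. -/
structure MaximalTree (Γ : SerreGraph.{u₁, u₂}) where
  edges : Set Γ.E
  inv_mem : ∀ e ∈ edges, Γ.inv e ∈ edges
  isTree : (Γ.spanningSubgraph edges inv_mem).IsTree

/-- The path distance between two vertices (`⊤` if there is no path). -/
noncomputable def edist (Γ : SerreGraph.{u₁, u₂}) (a b : Γ.V) : ℕ∞ :=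
  ⨅ (l : List Γ.E) (_ : Γ.IsPath a l b), (l.length : ℕ∞)

/-- The diameter of a set of vertices. -/
noncomputable def diam (Γ : SerreGraph.{u₁, u₂}) (S : Set Γ.V) : ℕ∞ :=
  ⨆ (a ∈ S) (b ∈ S), Γ.edist a b

/-- Unoriented edges: the edges modulo `e ∼ inv e`. -/
def UnorientedEdge (Γ : SerreGraph.{u₁, u₂}) : Type u₂ :=
  Quot fun e f : Γ.E => f = Γ.inv e

/-- The unoriented edge underlying an edge. -/
def unoriented (Γ : SerreGraph.{u₁, u₂}) (e : Γ.E) : Γ.UnorientedEdge := Quot.mk _ e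

theorem unoriented_inv (Γ : SerreGraph.{u₁, u₂}) (e : Γ.E) :
    Γ.unoriented e = Γ.unoriented (Γ.inv e) := Quot.sound rfl

/-- The given actions of `G` on the vertices and on the edges of `T` are an action of `G` on the
graph `T` without inversion. -/
class ActsWithoutInversion (G : Type*) [Group G] (T : SerreGraph.{u₁, u₂})
    [MulAction G T.V] [MulAction G T.E] : Prop where
  src_smul : ∀ (g : G) (e : T.E), T.src (g • e) = g • T.src e
  inv_smul : ∀ (g : G) (e : T.E), T.inv (g • e) = g • T.inv e
  smul_ne_inv : ∀ (g : G) (e : T.E), g • e ≠ T.inv e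

/-- `h` is elliptic if it fixes a vertex. -/
def IsElliptic {G : Type*} [Group G] (T : SerreGraph.{u₁, u₂}) [MulAction G T.V] (h : G) : Prop :=
  ∃ a : T.V, h • a = a

/-- The action of `G` on `T` is Sela-acylindrical: there is `k` such that the fixed-point set of
every nontrivial elliptic element has diameter at most `k`. -/
def IsSelaAcylindrical (G : Type*) [Group G] (T : SerreGraph.{u₁, u₂})
    [MulAction G T.V] [MulAction G T.E] [ActsWithoutInversion G T] : Prop :=
  ∃ k : ℕ, ∀ h : G, h ≠ 1 → T.IsElliptic h →
    T.diam (MulAction.fixedPoints (Subgroup.zpowers h) T.V) ≤ k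

end SerreGraph

/-- A graph of groups on `Γ`. Edge groups are indexed by unoriented edges, which gives
`G_e = G_{inv e}`; the monomorphism `φ e` goes from `G_e` to the group of the initial vertex
of `e`, hence `φ (inv e)` goes to the group of the terminal vertex. -/
structure GraphOfGroups (Γ : SerreGraph.{u₁, u₂}) where
  vertexGroup : Γ.V → Type u₃
  edgeGroup : Γ.UnorientedEdge → Type u₄
  [vertexGroupGroup : ∀ v, Group (vertexGroup v)]
  [edgeGroupGroup : ∀ e, Group (edgeGroup e)]
  φ : ∀ e : Γ.E, edgeGroup (Γ.unoriented e) →* vertexGroup (Γ.src e)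
  φ_injective : ∀ e, Function.Injective (φ e)

namespace GraphOfGroups

attribute [instance] GraphOfGroups.vertexGroupGroup GraphOfGroups.edgeGroupGroup

variable {Γ : SerreGraph.{u₁, u₂}} (𝒢 : GraphOfGroups.{u₁, u₂, u₃, u₄} Γ)

/-- The identity `G_e = G_{inv e}`. -/
def edgeCast (e : Γ.E) (a : 𝒢.edgeGroup (Γ.unoriented e)) :
    𝒢.edgeGroup (Γ.unoriented (Γ.inv e)) :=
  cast (congrArg 𝒢.edgeGroup (Γ.unoriented_inv e)) a

/-- The free product of all vertex groups and the free group on the edges. -/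
abbrev PreGroup : Type _ :=
  Monoid.Coprod (Monoid.CoprodI 𝒢.vertexGroup) (FreeGroup Γ.E)

/-- A vertex group element in the free product. -/
def preVertex {v : Γ.V} (x : 𝒢.vertexGroup v) : 𝒢.PreGroup :=
  Monoid.Coprod.inl (Monoid.CoprodI.of x)

/-- The letter of an edge in the free product. -/
def preEdge (e : Γ.E) : 𝒢.PreGroup := Monoid.Coprod.inr (FreeGroup.of e)

/-- The relators: `t_e t_{inv e}` and `t_e⁻¹ φ_e(a) t_e φ_{inv e}(a)⁻¹` for all edges `e` and
`a ∈ G_e`, and `t_e` for all `e` in the maximal tree. -/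
inductive IsRelator (T₀ : Γ.MaximalTree) : 𝒢.PreGroup → Prop
  | inv (e : Γ.E) : IsRelator T₀ (𝒢.preEdge e * 𝒢.preEdge (Γ.inv e))
  | conj (e : Γ.E) (a : 𝒢.edgeGroup (Γ.unoriented e)) :
      IsRelator T₀ ((𝒢.preEdge e)⁻¹ * 𝒢.preVertex (𝒢.φ e a) * 𝒢.preEdge e *
        (𝒢.preVertex (𝒢.φ (Γ.inv e) (𝒢.edgeCast e a)))⁻¹)
  | tree (e : Γ.E) (he : e ∈ T₀.edges) : IsRelator T₀ (𝒢.preEdge e)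

/-- The fundamental group of the graph of groups with respect to a maximal tree. -/
def FundamentalGroup (T₀ : Γ.MaximalTree) : Type _ :=
  𝒢.PreGroup ⧸ Subgroup.normalClosure {x | 𝒢.IsRelator T₀ x}

variable (T₀ : Γ.MaximalTree)

instance : Group (𝒢.FundamentalGroup T₀) :=
  inferInstanceAs (Group (𝒢.PreGroup ⧸ Subgroup.normalClosure {x | 𝒢.IsRelator T₀ x}))

/-- The quotient map onto the fundamental group. -/
def toFundamentalGroup : 𝒢.PreGroup →* 𝒢.FundamentalGroup T₀ :=
  QuotientGroup.mk' (Subgroup.normalClosure {x | 𝒢.IsRelator T₀ x})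

theorem toFundamentalGroup_relator {x : 𝒢.PreGroup} (h : 𝒢.IsRelator T₀ x) :
    𝒢.toFundamentalGroup T₀ x = 1 :=
  (QuotientGroup.eq_one_iff (N := Subgroup.normalClosure {x | 𝒢.IsRelator T₀ x}) x).2
    (Subgroup.subset_normalClosure h)

/-- The canonical homomorphism from a vertex group to the fundamental group. -/
def ofVertex (v : Γ.V) : 𝒢.vertexGroup v →* 𝒢.FundamentalGroup T₀ :=
  (𝒢.toFundamentalGroup T₀).comp (Monoid.Coprod.inl.comp Monoid.CoprodI.of)

/-- The stable letter of an edge in the fundamental group. -/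
def stableLetter (e : Γ.E) : 𝒢.FundamentalGroup T₀ :=
  𝒢.toFundamentalGroup T₀ (𝒢.preEdge e)

theorem stableLetter_mul_inv (e : Γ.E) :
    𝒢.stableLetter T₀ e * 𝒢.stableLetter T₀ (Γ.inv e) = 1 := by
  have h := 𝒢.toFundamentalGroup_relator T₀ (IsRelator.inv e)
  rwa [map_mul] at h

theorem stableLetter_conj (e : Γ.E) (a : 𝒢.edgeGroup (Γ.unoriented e)) :
    (𝒢.stableLetter T₀ e)⁻¹ * 𝒢.ofVertex T₀ _ (𝒢.φ e a) * 𝒢.stableLetter T₀ e =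
      𝒢.ofVertex T₀ _ (𝒢.φ (Γ.inv e) (𝒢.edgeCast e a)) := by
  have h := 𝒢.toFundamentalGroup_relator T₀ (IsRelator.conj e a)
  rw [map_mul, map_inv, mul_inv_eq_one, map_mul, map_mul, map_inv] at h
  exact h

/-- The image of `G_v` in the fundamental group. -/
def vertexSubgroup (v : Γ.V) : Subgroup (𝒢.FundamentalGroup T₀) := (𝒢.ofVertex T₀ v).range

/-- The image of `φ_e(G_e)` in the fundamental group. -/
def edgeSubgroup (e : Γ.E) : Subgroup (𝒢.FundamentalGroup T₀) :=
  ((𝒢.ofVertex T₀ (Γ.src e)).comp (𝒢.φ e)).range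

theorem edgeSubgroup_le (e : Γ.E) : 𝒢.edgeSubgroup T₀ e ≤ 𝒢.vertexSubgroup T₀ (Γ.src e) := by
  rintro _ ⟨a, rfl⟩
  exact ⟨𝒢.φ e a, rfl⟩

/-- The map `g φ_e(G_e) ↦ g t_e φ_{inv e}(G_e)` on cosets. -/
def invCoset (e : Γ.E) : 𝒢.FundamentalGroup T₀ ⧸ 𝒢.edgeSubgroup T₀ e →
    𝒢.FundamentalGroup T₀ ⧸ 𝒢.edgeSubgroup T₀ (Γ.inv e) :=
  Quotient.map' (fun g => g * 𝒢.stableLetter T₀ e) (by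
    intro x y h
    rw [QuotientGroup.leftRel_apply] at h ⊢
    obtain ⟨a, ha⟩ := h
    refine ⟨𝒢.edgeCast e a, ?_⟩
    have h2 := 𝒢.stableLetter_conj T₀ e a
    simp only [MonoidHom.comp_apply] at ha ⊢
    rw [← h2, ha]
    group)

theorem sigma_coset_eq {e e' : Γ.E} (h : e = e') (g : 𝒢.FundamentalGroup T₀) :
    (⟨e, QuotientGroup.mk g⟩ : Σ e, 𝒢.FundamentalGroup T₀ ⧸ 𝒢.edgeSubgroup T₀ e) =
      ⟨e', QuotientGroup.mk g⟩ := by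
  subst h; rfl

/-- The Bass–Serre tree. Its vertices are the cosets `g G_v`, its edges the cosets `g φ_e(G_e)`;
the edge `g φ_e(G_e)` starts at `g G_{src e}`, and its inverse is `g t_e φ_{inv e}(G_e)`, so that
it ends at `g t_e G_{tgt e}`. -/
def bassSerreTree : SerreGraph where
  V := Σ v, 𝒢.FundamentalGroup T₀ ⧸ 𝒢.vertexSubgroup T₀ v
  E := Σ e, 𝒢.FundamentalGroup T₀ ⧸ 𝒢.edgeSubgroup T₀ e
  src x := ⟨Γ.src x.1, Subgroup.quotientMapOfLE (𝒢.edgeSubgroup_le T₀ x.1) x.2⟩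
  inv x := ⟨Γ.inv x.1, 𝒢.invCoset T₀ x.1 x.2⟩
  inv_inv := by
    rintro ⟨e, x⟩
    induction x using QuotientGroup.induction_on with
    | H g =>
      have h : g * 𝒢.stableLetter T₀ e * 𝒢.stableLetter T₀ (Γ.inv e) = g := by
        rw [mul_assoc, stableLetter_mul_inv, mul_one]
      have h2 := 𝒢.sigma_coset_eq T₀ (Γ.inv_inv e)
        (g * 𝒢.stableLetter T₀ e * 𝒢.stableLetter T₀ (Γ.inv e))
      exact h2.trans (by rw [h])
  inv_ne x h := Γ.inv_ne x.1 (congrArg Sigma.fst h)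

/-- The action on the vertices by left multiplication of cosets. -/
instance : MulAction (𝒢.FundamentalGroup T₀) (𝒢.bassSerreTree T₀).V :=
  inferInstanceAs (MulAction (𝒢.FundamentalGroup T₀)
    (Σ v, 𝒢.FundamentalGroup T₀ ⧸ 𝒢.vertexSubgroup T₀ v))

/-- The action on the edges by left multiplication of cosets. -/
instance : MulAction (𝒢.FundamentalGroup T₀) (𝒢.bassSerreTree T₀).E :=
  inferInstanceAs (MulAction (𝒢.FundamentalGroup T₀)
    (Σ e, 𝒢.FundamentalGroup T₀ ⧸ 𝒢.edgeSubgroup T₀ e))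

instance : SerreGraph.ActsWithoutInversion (𝒢.FundamentalGroup T₀) (𝒢.bassSerreTree T₀) where
  src_smul := by
    rintro g ⟨e, x⟩
    induction x using QuotientGroup.induction_on with
    | H y => rfl
  inv_smul := by
    rintro g ⟨e, x⟩
    induction x using QuotientGroup.induction_on with
    | H y =>
      refine congrArg (Sigma.mk (Γ.inv e)) ?_
      exact congrArg QuotientGroup.mk (mul_assoc g y (𝒢.stableLetter T₀ e))
  smul_ne_inv g x h := Γ.inv_ne x.1 (congrArg Sigma.fst h).symm

end GraphOfGroups

/-!
A group `G` acting acylindrically on a tree with balanced vertex stabilizers is balanced. Let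
`g h ^ k g⁻¹ = h ^ l` with `h` of infinite order.

* If `h` fixes no vertex, the displacements of the powers of `h` grow strictly
  (`add_le_sepDist_pow`), while the displacements of the conjugate elements `h ^ (k n)` and
  `h ^ (l n)` differ by at most a constant that does not depend on `n`. So `|k| = |l|`
  (`abs_le_abs_of_not_isElliptic`).
* If `h` fixes a vertex, consider the vertices fixed by some nontrivial power of `h`. Any two of
  them are fixed by a common power, so acylindricity bounds their distance. The relation shows that
  `g⁻¹` preserves this bounded set, as does `h⁻¹`. Its centre is then fixed by `g` and `h`
  (`exists_common_fixed`), so both lie in a vertex stabilizer, which is balanced.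

The metric geometry uses only that the graph is connected and that every edge separates it. This is
recorded by a sign function on the vertices for each edge (`CutSystem`). The cuts are nested, which
gives the four-point condition (`four_point`); from it follow both the dichotomy above and the
existence of centres.

The facts about the fundamental group come from homomorphisms out of it rather than from normal
forms. A family of homomorphisms on the vertex groups with compatible labels of the edges induces
a homomorphism even if the labels of the maximal tree are nontrivial: they are removed by
conjugating with a potential (`PreHom.lift`). This is applied twice.

* All vertex groups act freely on one large set in such a way that, for every edge, the two induced
  actions of the edge group are conjugate. The resulting permutation representation shows that the
  vertex groups embed (`ofVertex_injective`).
* Mapping into the extension of the sign functions on the edges of the Bass–Serre tree by the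
  fundamental group yields the cuts of the Bass–Serre tree (`cutSystem`).
-/

/-! ### Group-valued potentials on trees -/

namespace SerreGraph

variable {Γ : SerreGraph.{u₁, u₂}} {H : Type*} [Group H]

theorem isPath_append {a b : Γ.V} {l₁ l₂ : List Γ.E} :
    Γ.IsPath a (l₁ ++ l₂) b ↔ ∃ c, Γ.IsPath a l₁ c ∧ Γ.IsPath c l₂ b := by
  induction l₁ generalizing a with
  | nil => simp [IsPath]
  | cons e l ih => simp [IsPath, ih, and_assoc]

theorem tgt_inv (e : Γ.E) : Γ.tgt (Γ.inv e) = Γ.src e := by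
  rw [tgt, Γ.inv_inv]

/-- Edge labels that are inverted with the edges multiply to `1` along a closed path in a tree,
since backtrackings cancel. -/
theorem IsTree.prod_map_eq_one (hΓ : Γ.IsTree) {f : Γ.E → H}
    (hf : ∀ e, f (Γ.inv e) = (f e)⁻¹) (a : Γ.V) (l : List Γ.E) (hl : Γ.IsPath a l a) :
    (l.map f).prod = 1 := by
  induction hn : l.length using Nat.strong_induction_on generalizing l with
  | _ n ih =>
    rcases hΓ.closed_path a l hl with rfl | ⟨l₁, l₂, e, rfl⟩
    · simp
    · obtain ⟨c, h₁, h₂⟩ := isPath_append.1 hl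
      obtain ⟨rfl, -, h₃⟩ := h₂
      rw [tgt_inv] at h₃
      have := ih (l₁ ++ l₂).length (by rw [← hn]; simp) _ (isPath_append.2 ⟨_, h₁, h₃⟩) rfl
      simpa [hf] using this

theorem IsTree.prod_map_eq (hΓ : Γ.IsTree) {f : Γ.E → H}
    (hf : ∀ e, f (Γ.inv e) = (f e)⁻¹) {a b : Γ.V} {l₁ l₂ : List Γ.E}
    (h₁ : Γ.IsPath a l₁ b) (h₂ : Γ.IsPath a l₂ b) :
    (l₁.map f).prod = (l₂.map f).prod := by
  obtain ⟨q, hq⟩ := hΓ.connected b a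
  have e₁ := hΓ.prod_map_eq_one hf a _ (isPath_append.2 ⟨b, h₁, hq⟩)
  have e₂ := hΓ.prod_map_eq_one hf a _ (isPath_append.2 ⟨b, h₂, hq⟩)
  rw [List.map_append, List.prod_append] at e₁ e₂
  exact mul_right_cancel (e₁.trans e₂.symm)

namespace MaximalTree

variable (T₀ : Γ.MaximalTree)

/-- The maximal tree as a graph in its own right. -/
abbrev graph : SerreGraph.{u₁, u₂} := Γ.spanningSubgraph T₀.edges T₀.inv_mem

/-- The inclusion of the edges of the maximal tree. -/
def incl (e : T₀.graph.E) : Γ.E := Subtype.val e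

theorem incl_mem (e : T₀.graph.E) : T₀.incl e ∈ T₀.edges := Subtype.property e

/-- A path in the maximal tree from a fixed root to `v`. -/
noncomputable def pathFromRoot (v : Γ.V) : List T₀.graph.E :=
  (T₀.isTree.connected T₀.isTree.nonempty.some v).choose

/-- The product of the edge labels `f` along the path in the maximal tree from the root to `v`. -/
noncomputable def potential (f : Γ.E → H) (v : Γ.V) : H :=
  ((T₀.pathFromRoot v).map fun e => f (T₀.incl e)).prod

theorem potential_tgt {f : Γ.E → H} (hf : ∀ e, f (Γ.inv e) = (f e)⁻¹) {e : Γ.E}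
    (he : e ∈ T₀.edges) :
    T₀.potential f (Γ.tgt e) = T₀.potential f (Γ.src e) * f e := by
  have hsrc := (T₀.isTree.connected T₀.isTree.nonempty.some (Γ.src e)).choose_spec
  have htgt := (T₀.isTree.connected T₀.isTree.nonempty.some (Γ.tgt e)).choose_spec
  let e' : T₀.graph.E := ⟨e, he⟩
  have he' : T₀.graph.IsPath (Γ.src e) [e'] (Γ.tgt e) := ⟨rfl, rfl⟩
  have := T₀.isTree.prod_map_eq (f := fun e : T₀.graph.E => f (T₀.incl e))
    (fun e => hf (T₀.incl e)) htgt (isPath_append.2 ⟨_, hsrc, he'⟩)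
  rw [List.map_append, List.prod_append, List.map_singleton, List.prod_singleton] at this
  exact this

theorem map_potential {H' : Type*} [Group H'] (ψ : H →* H') (f : Γ.E → H) (v : Γ.V) :
    ψ (T₀.potential f v) = T₀.potential (fun e => ψ (f e)) v := by
  rw [potential, potential, map_list_prod, List.map_map]
  rfl

theorem potential_eq_one {f : Γ.E → H} (hf : ∀ e ∈ T₀.edges, f e = 1) (v : Γ.V) :
    T₀.potential f v = 1 := by
  apply List.prod_eq_one
  intro x hx
  obtain ⟨e, -, rfl⟩ := List.mem_map.1 hx
  exact hf (Subtype.val e) (Subtype.property e)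

end MaximalTree

end SerreGraph

/-! ### Homomorphisms from the fundamental group -/

namespace GraphOfGroups

variable {Γ : SerreGraph.{u₁, u₂}} (𝒢 : GraphOfGroups.{u₁, u₂, u₃, u₄} Γ) (T₀ : Γ.MaximalTree)
  {H : Type*} [Group H]

theorem subgroup_eq_top (S : Subgroup (𝒢.FundamentalGroup T₀))
    (hv : ∀ v x, 𝒢.ofVertex T₀ v x ∈ S) (he : ∀ e, 𝒢.stableLetter T₀ e ∈ S) : S = ⊤ := by
  rw [eq_top_iff]
  rintro g -
  obtain ⟨w, rfl⟩ := QuotientGroup.mk'_surjective _ g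
  change 𝒢.toFundamentalGroup T₀ w ∈ S
  induction w using Monoid.Coprod.induction_on with
  | inl w =>
    induction w using Monoid.CoprodI.induction_on with
    | one => simp [S.one_mem]
    | of v x => exact hv v x
    | mul x y hx hy => rw [map_mul, map_mul]; exact S.mul_mem hx hy
  | inr w =>
    induction w using FreeGroup.induction_on with
    | C1 => simp [S.one_mem]
    | of e => exact he e
    | inv_of e h => rw [map_inv, map_inv]; exact S.inv_mem h
    | mul x y hx hy => rw [map_mul, map_mul]; exact S.mul_mem hx hy
  | mul x y hx hy => rw [map_mul]; exact S.mul_mem hx hy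

theorem fundamentalGroup_hom_ext {F F' : 𝒢.FundamentalGroup T₀ →* H}
    (hv : ∀ v x, F (𝒢.ofVertex T₀ v x) = F' (𝒢.ofVertex T₀ v x))
    (he : ∀ e, F (𝒢.stableLetter T₀ e) = F' (𝒢.stableLetter T₀ e)) : F = F' := by
  have h := 𝒢.subgroup_eq_top T₀ (F.eqLocus F') hv he
  ext g
  exact (h ▸ Subgroup.mem_top g : g ∈ F.eqLocus F')

/-- Homomorphisms `α v` from the vertex groups and labels `f` of the edges that satisfy the
relations of the graph of groups, except possibly those of the maximal tree. -/
structure PreHom (H : Type*) [Group H] where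
  α : ∀ v, 𝒢.vertexGroup v →* H
  f : Γ.E → H
  f_inv : ∀ e, f (Γ.inv e) = (f e)⁻¹
  conj : ∀ e a, (f e)⁻¹ * α _ (𝒢.φ e a) * f e = α _ (𝒢.φ (Γ.inv e) (𝒢.edgeCast e a))

namespace PreHom

variable {𝒢} (D : 𝒢.PreHom H)

/-- The homomorphism on the free product: conjugating by the potential of `f` along the maximal
tree makes the letters of the tree edges trivial. -/
noncomputable def preLift : 𝒢.PreGroup →* H :=
  Monoid.Coprod.lift
    (Monoid.CoprodI.lift fun v =>
      (MulAut.conj (T₀.potential D.f v)).toMonoidHom.comp (D.α v))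
    (FreeGroup.lift fun e =>
      T₀.potential D.f (Γ.src e) * D.f e * (T₀.potential D.f (Γ.tgt e))⁻¹)

theorem preLift_preVertex {v : Γ.V} (x : 𝒢.vertexGroup v) :
    D.preLift T₀ (𝒢.preVertex x) =
      T₀.potential D.f v * D.α v x * (T₀.potential D.f v)⁻¹ := by
  simp [preLift, preVertex]

theorem preLift_preEdge (e : Γ.E) :
    D.preLift T₀ (𝒢.preEdge e) =
      T₀.potential D.f (Γ.src e) * D.f e * (T₀.potential D.f (Γ.tgt e))⁻¹ := by
  simp [preLift, preEdge]

theorem preLift_relator {x : 𝒢.PreGroup} (hx : 𝒢.IsRelator T₀ x) : D.preLift T₀ x = 1 := by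
  cases hx with
  | inv e =>
    rw [map_mul, preLift_preEdge, preLift_preEdge, D.f_inv, SerreGraph.tgt_inv]
    change _ * (T₀.potential D.f (Γ.tgt e) * _ * _) = _
    group
  | conj e a =>
    rw [map_mul, map_mul, map_mul, map_inv, map_inv, preLift_preEdge, preLift_preVertex,
      preLift_preVertex, ← D.conj]
    change _ * (T₀.potential D.f (Γ.tgt e) * _ * _)⁻¹ = _
    rw [mul_inv_eq_one]
    change _ = T₀.potential D.f (Γ.tgt e) * _ * (T₀.potential D.f (Γ.tgt e))⁻¹
    group
  | tree e he =>
    rw [preLift_preEdge, T₀.potential_tgt D.f_inv he, mul_inv_cancel]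

/-- The homomorphism from the fundamental group induced by `D`. -/
noncomputable def lift : 𝒢.FundamentalGroup T₀ →* H :=
  QuotientGroup.lift _ (D.preLift T₀)
    (Subgroup.normalClosure_le_normal (N := (D.preLift T₀).ker)
      fun _ hx => D.preLift_relator T₀ hx)

theorem lift_ofVertex (v : Γ.V) (x : 𝒢.vertexGroup v) :
    D.lift T₀ (𝒢.ofVertex T₀ v x) =
      T₀.potential D.f v * D.α v x * (T₀.potential D.f v)⁻¹ :=
  D.preLift_preVertex T₀ x

theorem lift_stableLetter (e : Γ.E) :
    D.lift T₀ (𝒢.stableLetter T₀ e) =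
      T₀.potential D.f (Γ.src e) * D.f e * (T₀.potential D.f (Γ.tgt e))⁻¹ :=
  D.preLift_preEdge T₀ e

end PreHom

end GraphOfGroups

/-! ### Fixed points in graphs in which every edge separates -/

namespace SerreGraph

variable {T : SerreGraph.{u₁, u₂}}

open Classical in
/-- `-1` if `η` is `ε` or its inverse, and `1` otherwise. -/
noncomputable def edgeSign (ε η : T.E) : ℤˣ := if η = ε ∨ η = T.inv ε then -1 else 1

theorem inv_eq_iff {ε η : T.E} : T.inv ε = η ↔ ε = T.inv η :=
  ⟨fun h => by rw [← h, T.inv_inv], fun h => by rw [h, T.inv_inv]⟩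

theorem edgeSign_inv (ε η : T.E) : edgeSign ε (T.inv η) = edgeSign ε η := by
  unfold edgeSign
  congr 1
  rw [inv_eq_iff, inv_eq_iff, T.inv_inv, or_comm]

theorem edgeSign_of_eq {ε η : T.E} (h : η = ε ∨ η = T.inv ε) : edgeSign ε η = -1 := if_pos h

theorem edgeSign_of_ne {ε η : T.E} (h : ¬ (η = ε ∨ η = T.inv ε)) : edgeSign ε η = 1 := if_neg h

/-- A consistent choice, for every edge `ε`, of a two-colouring of the vertices such that `ε` and
its inverse are the only edges whose endpoints have different colours. Hence removing `ε`
separates the graph. -/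
structure CutSystem (T : SerreGraph.{u₁, u₂}) where
  sign : T.E → T.V → ℤˣ
  sign_tgt : ∀ ε η, sign ε (T.tgt η) = sign ε (T.src η) * edgeSign ε η

/-- There is a path from `a` to `b`. -/
def Reachable (T : SerreGraph.{u₁, u₂}) : T.V → T.V → Prop :=
  Relation.ReflTransGen fun a b => ∃ e, T.src e = a ∧ T.tgt e = b

theorem Reachable.edge (e : T.E) : T.Reachable (T.src e) (T.tgt e) := .single ⟨e, rfl, rfl⟩

theorem Reachable.symm {a b : T.V} (h : T.Reachable a b) : T.Reachable b a := by
  induction h with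
  | refl => exact .refl
  | tail _ he ih =>
    obtain ⟨e, rfl, rfl⟩ := he
    exact .head ⟨T.inv e, rfl, tgt_inv e⟩ ih

theorem tgt_smul {G : Type*} [Group G] [MulAction G T.V] [MulAction G T.E]
    [ActsWithoutInversion G T] (g : G) (e : T.E) : T.tgt (g • e) = g • T.tgt e := by
  rw [tgt, ActsWithoutInversion.inv_smul, ActsWithoutInversion.src_smul, tgt]

theorem Reachable.smul {G : Type*} [Group G] [MulAction G T.V] [MulAction G T.E]
    [ActsWithoutInversion G T] (g : G) {a b : T.V} (h : T.Reachable a b) :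
    T.Reachable (g • a) (g • b) := by
  induction h with
  | refl => exact .refl
  | tail _ he ih =>
    obtain ⟨e, rfl, rfl⟩ := he
    refine ih.tail ⟨g • e, ActsWithoutInversion.src_smul g e, tgt_smul g e⟩

theorem edgeSign_smul {G : Type*} [Group G] [MulAction G T.V] [MulAction G T.E]
    [ActsWithoutInversion G T] (g : G) (ε η : T.E) :
    edgeSign (g • ε) (g • η) = edgeSign ε η := by
  unfold edgeSign
  congr 1
  rw [ActsWithoutInversion.inv_smul, smul_left_cancel_iff, smul_left_cancel_iff]

theorem edgeSign_inv_smul {G : Type*} [Group G] [MulAction G T.V] [MulAction G T.E]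
    [ActsWithoutInversion G T] (g : G) (ε η : T.E) :
    edgeSign (g⁻¹ • ε) η = edgeSign ε (g • η) := by
  rw [← edgeSign_smul g, smul_inv_smul]

namespace CutSystem

variable (C : T.CutSystem)

/-- The oriented edges that separate `x` from `y`. -/
def sep (x y : T.V) : Set T.E := {ε | C.sign ε x ≠ C.sign ε y}

theorem _root_.Int.units_ne_iff_mul_eq_neg_one (a b : ℤˣ) : a ≠ b ↔ a * b = -1 := by
  decide +revert

theorem mem_sep_iff_mul {ε : T.E} {x y : T.V} :
    ε ∈ C.sep x y ↔ C.sign ε x * C.sign ε y = -1 :=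
  Int.units_ne_iff_mul_eq_neg_one _ _

/-- The number of oriented edges that separate `x` from `y`. In a tree this is twice the path
distance, as each edge is counted with both orientations. -/
noncomputable def sepDist (x y : T.V) : ℕ := (C.sep x y).ncard

theorem sep_self (x : T.V) : C.sep x x = ∅ := by simp [sep]

theorem sep_comm (x y : T.V) : C.sep x y = C.sep y x := by
  ext ε; exact ne_comm

theorem sepDist_self (x : T.V) : C.sepDist x x = 0 := by simp [sepDist, sep_self]

theorem sepDist_comm (x y : T.V) : C.sepDist x y = C.sepDist y x := by
  rw [sepDist, sep_comm, sepDist]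

theorem sep_edge (η : T.E) : C.sep (T.src η) (T.tgt η) = {η, T.inv η} := by
  ext ε
  have h1 : (η = ε ∨ η = T.inv ε) ↔ (ε = η ∨ ε = T.inv η) := by
    rw [eq_comm, ← inv_eq_iff, eq_comm (a := T.inv η)]
  simp only [sep, Set.mem_ofPred_eq, Set.mem_insert_iff, Set.mem_singleton_iff, C.sign_tgt]
  rw [← h1]
  by_cases h : η = ε ∨ η = T.inv ε
  · simp only [edgeSign_of_eq h, h, iff_true]
    generalize C.sign ε (T.src η) = a; decide +revert
  · simp [edgeSign_of_ne h, h]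

theorem sepDist_edge (η : T.E) : C.sepDist (T.src η) (T.tgt η) = 2 := by
  rw [sepDist, sep_edge, Set.ncard_pair (T.inv_ne η).symm]

theorem sep_subset (x y z : T.V) : C.sep x z ⊆ C.sep x y ∪ C.sep y z := by
  intro ε h
  by_contra h'
  simp only [sep, Set.mem_union, Set.mem_ofPred_eq, not_or, not_not] at h h'
  exact h (h'.1.trans h'.2)

variable {C}

theorem finite_sep {x y : T.V} (h : T.Reachable x y) : (C.sep x y).Finite := by
  induction h with
  | refl => simp [sep_self]
  | tail _ he ih =>
    obtain ⟨e, rfl, rfl⟩ := he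
    refine (ih.union ?_).subset (C.sep_subset _ _ _)
    simp [sep_edge]

variable (hT : ∀ x y, T.Reachable x y)

include hT

theorem sepDist_triangle (x y z : T.V) : C.sepDist x z ≤ C.sepDist x y + C.sepDist y z :=
  (Set.ncard_le_ncard (C.sep_subset x y z) ((finite_sep (hT _ _)).union (finite_sep (hT _ _)))).trans
    (Set.ncard_union_le _ _)

theorem sepDist_le_of_isPath {x y : T.V} {l : List T.E} (h : T.IsPath x l y) :
    C.sepDist x y ≤ 2 * l.length := by
  induction l generalizing x with
  | nil => obtain rfl : x = y := h; simp [sepDist_self]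
  | cons e l ih =>
    obtain ⟨rfl, h⟩ := h
    have h1 := sepDist_triangle (C := C) hT (T.src e) (T.tgt e) y
    have h2 := ih h
    rw [sepDist_edge] at h1
    simp only [List.length_cons]
    omega

/-- A sign function on the vertices is determined up to a global sign by its changes along the
edges. -/
theorem sign_mul_eq {s s' : T.V → ℤˣ} {f : T.E → ℤˣ} (hs : ∀ η, s (T.tgt η) = s (T.src η) * f η)
    (hs' : ∀ η, s' (T.tgt η) = s' (T.src η) * f η) (x y : T.V) : s x * s y = s' x * s' y := by
  induction hT x y with
  | refl => simp [← sq]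
  | tail _ he ih =>
    obtain ⟨e, rfl, rfl⟩ := he
    rw [hs, hs', ← mul_assoc, ih, mul_assoc]

theorem mem_sep_inv {ε : T.E} {x y : T.V} : T.inv ε ∈ C.sep x y ↔ ε ∈ C.sep x y := by
  have h : ∀ η, edgeSign (T.inv ε) η = edgeSign ε η := fun η => by
    unfold edgeSign; congr 1; rw [T.inv_inv, or_comm]
  have := sign_mul_eq hT (fun η => C.sign_tgt ε η)
    (fun η => (C.sign_tgt (T.inv ε) η).trans (by rw [h])) x y
  rw [mem_sep_iff_mul, mem_sep_iff_mul, this]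

/-- Two distinct cuts are nested: every vertex lies on the side of `ε'` that contains `ε`, or on
the side of `ε` that contains `ε'`. -/
theorem sign_eq_or_sign_eq {ε ε' : T.E} (hne : ¬ (ε' = ε ∨ ε' = T.inv ε)) (x : T.V) :
    C.sign ε' x = C.sign ε' (T.src ε) ∨ C.sign ε x = C.sign ε (T.src ε') := by
  have hne' : ¬ (ε = ε' ∨ ε = T.inv ε') := by rwa [eq_comm, ← inv_eq_iff, eq_comm (a := T.inv ε)]
  have h1 := C.sign_tgt ε' ε
  rw [edgeSign_of_ne hne', mul_one] at h1
  have h2 := C.sign_tgt ε ε'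
  rw [edgeSign_of_ne hne, mul_one] at h2
  induction hT (T.src ε) x with
  | refl => exact .inl rfl
  | tail _ he ih =>
    obtain ⟨e, rfl, rfl⟩ := he
    by_cases he : e = ε ∨ e = T.inv ε
    · left
      rcases he with rfl | rfl
      · exact h1
      · rw [tgt_inv]
    by_cases he' : e = ε' ∨ e = T.inv ε'
    · right
      rcases he' with rfl | rfl
      · exact h2
      · rw [tgt_inv]
    rwa [C.sign_tgt, C.sign_tgt, edgeSign_of_ne he, edgeSign_of_ne he', mul_one, mul_one]

/-- Two edges cannot split four vertices into pairs in two different ways. -/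
theorem not_crossing {ε ε' : T.E} {x y z w : T.V} (h₁ : ε ∉ C.sep x z) (h₂ : ε ∉ C.sep y w)
    (h₃ : ε ∈ C.sep x y) (h₁' : ε' ∉ C.sep x w) (h₂' : ε' ∉ C.sep y z) (h₃' : ε' ∈ C.sep x y) :
    False := by
  by_cases hne : ε' = ε ∨ ε' = T.inv ε
  · have h : ε ∉ C.sep x w := by
      rcases hne with rfl | rfl
      · exact h₁'
      · rwa [mem_sep_inv hT] at h₁'
    simp only [sep, Set.mem_ofPred_eq, not_not] at *
    exact h₃ (h.trans h₂.symm)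
  · have hx := sign_eq_or_sign_eq hT (C := C) hne x
    have hy := sign_eq_or_sign_eq hT (C := C) hne y
    have hz := sign_eq_or_sign_eq hT (C := C) hne z
    have hw := sign_eq_or_sign_eq hT (C := C) hne w
    simp only [sep, Set.mem_ofPred_eq, not_not] at *
    rw [← h₁, ← h₂'] at hz
    rw [← h₂, ← h₁'] at hw
    grind

/-- The two distances on the right dominate those on the left unless some edge separates `x` and
`z` from `y` and `w`. -/
theorem sepDist_add_le {x y z w : T.V}
    (h : ∀ ε, ε ∈ C.sep x y → ε ∉ C.sep x z → ε ∈ C.sep y w) :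
    C.sepDist x y + C.sepDist z w ≤ C.sepDist x z + C.sepDist y w := by
  have hf : ∀ x y, (C.sep x y).Finite := fun x y => finite_sep (hT x y)
  rw [sepDist, sepDist, sepDist, sepDist, ← Set.ncard_union_add_ncard_inter _ _ (hf _ _) (hf _ _),
    ← Set.ncard_union_add_ncard_inter (C.sep x z) _ (hf _ _) (hf _ _)]
  have key : ∀ ε, (ε ∈ C.sep x y → ε ∈ C.sep x z ∨ ε ∈ C.sep y w) ∧
      (ε ∈ C.sep z w → ε ∈ C.sep x z ∨ ε ∈ C.sep y w) ∧
      (ε ∈ C.sep x y → ε ∈ C.sep z w → ε ∈ C.sep x z ∧ ε ∈ C.sep y w) := by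
    intro ε
    have := h ε
    simp only [sep, Set.mem_ofPred_eq] at *
    rcases Int.units_eq_one_or (C.sign ε x) with hx | hx <;>
    rcases Int.units_eq_one_or (C.sign ε y) with hy | hy <;>
    rcases Int.units_eq_one_or (C.sign ε z) with hz | hz <;>
    rcases Int.units_eq_one_or (C.sign ε w) with hw | hw <;>
    simp_all
  refine add_le_add (Set.ncard_le_ncard ?_ ((hf _ _).union (hf _ _)))
    (Set.ncard_le_ncard ?_ ((hf _ _).inter_of_left _))
  · rintro ε (hε | hε)
    · exact (key ε).1 hε
    · exact (key ε).2.1 hε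
  · rintro ε ⟨h1, h2⟩
    exact (key ε).2.2 h1 h2

/-- The four-point condition: a graph with nested cuts is `0`-hyperbolic. -/
theorem four_point (x y z w : T.V) :
    C.sepDist x y + C.sepDist z w ≤
      max (C.sepDist x z + C.sepDist y w) (C.sepDist x w + C.sepDist y z) := by
  rw [le_max_iff]
  by_contra! hcon
  have h1 : ∃ ε, ε ∈ C.sep x y ∧ ε ∉ C.sep x z ∧ ε ∉ C.sep y w := by
    by_contra! h
    exact absurd (sepDist_add_le hT h) (not_le.2 hcon.1)
  have h2 : ∃ ε, ε ∈ C.sep x y ∧ ε ∉ C.sep x w ∧ ε ∉ C.sep y z := by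
    by_contra! h
    have := sepDist_add_le hT h
    rw [C.sepDist_comm w z] at this
    exact absurd this (not_le.2 hcon.2)
  obtain ⟨ε, a, b, c⟩ := h1
  obtain ⟨ε', a', b', c'⟩ := h2
  exact not_crossing hT b c a b' c' a'

/-- A vertex `x ≠ y` is the start of an edge that separates `x` from `y`. -/
theorem exists_edge {x y : T.V} (hxy : x ≠ y) : ∃ η, T.src η = x ∧ η ∈ C.sep x y := by
  induction hT x y with
  | refl => exact absurd rfl hxy
  | tail _ he ih =>
    obtain ⟨e, rfl, rfl⟩ := he
    by_cases h : x = T.src e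
    · refine ⟨e, h.symm, ?_⟩
      rw [h, sep_edge]
      exact .inl rfl
    · obtain ⟨η, rfl, h2⟩ := ih h
      refine ⟨η, rfl, ?_⟩
      have hne : ¬ (e = η ∨ e = T.inv η) := by
        rintro (rfl | rfl)
        · exact h rfl
        · exact hxy (tgt_inv η).symm
      rwa [sep, Set.mem_ofPred_eq, C.sign_tgt, edgeSign_of_ne hne, mul_one]

theorem sepDist_pos {x y : T.V} (hxy : x ≠ y) : 0 < C.sepDist x y := by
  obtain ⟨η, -, h⟩ := exists_edge (C := C) hT hxy
  exact (Set.ncard_pos (finite_sep (hT x y))).2 ⟨η, h⟩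

/-- If `η` separates its initial vertex from `y`, then its terminal vertex lies between them. -/
theorem sepDist_eq_add {η : T.E} {y : T.V} (h : η ∈ C.sep (T.src η) y) :
    C.sepDist (T.src η) y = C.sepDist (T.src η) (T.tgt η) + C.sepDist (T.tgt η) y := by
  refine le_antisymm (sepDist_triangle hT _ _ _) ?_
  have := sepDist_add_le (C := C) hT (x := T.src η) (y := T.tgt η) (z := y) (w := T.tgt η) ?_
  · rwa [sepDist_self, add_zero, C.sepDist_comm y] at this
  · intro ε hε hε'
    rw [sep_edge] at hε
    rcases hε with rfl | rfl
    · exact absurd h hε'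
    · exact absurd ((mem_sep_inv hT).2 h) hε'

section Action

variable {G : Type*} [Group G] [MulAction G T.V] [MulAction G T.E] [ActsWithoutInversion G T]

theorem sepDist_smul (g : G) (x y : T.V) : C.sepDist (g • x) (g • y) = C.sepDist x y := by
  have h : C.sep (g • x) (g • y) = (fun ε => g • ε) '' C.sep x y := by
    ext ε
    have h0 : ε ∈ (fun ε => g • ε) '' C.sep x y ↔ g⁻¹ • ε ∈ C.sep x y :=
      ⟨by rintro ⟨ε, h, rfl⟩; simpa using h, fun h => ⟨_, h, by simp⟩⟩
    have := sign_mul_eq hT (s := fun x => C.sign ε (g • x)) (f := fun η => edgeSign ε (g • η))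
      (s' := C.sign (g⁻¹ • ε)) (fun η => by rw [← tgt_smul, C.sign_tgt, ActsWithoutInversion.src_smul])
      (fun η => by rw [C.sign_tgt, edgeSign_inv_smul]) x y
    rw [h0, mem_sep_iff_mul, mem_sep_iff_mul, this]
  rw [sepDist, h, Set.ncard_image_of_injective _ (MulAction.injective g), sepDist]

/-- A nonempty bounded set of vertices has a centre, which is fixed by every group element whose
inverse maps the set into itself. -/
theorem exists_fixed_of_bounded {X : Set T.V} (hX : X.Nonempty) {n : ℕ}
    (hb : ∀ x ∈ X, ∀ y ∈ X, C.sepDist x y ≤ n) :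
    ∃ w : T.V, ∀ g : G, (∀ x ∈ X, g⁻¹ • x ∈ X) → g • w = w := by
  classical
  have hR : ∃ r w, ∀ x ∈ X, C.sepDist w x ≤ r := by
    obtain ⟨w, hw⟩ := hX
    exact ⟨n, w, hb w hw⟩
  set r := Nat.find hR with hr
  -- Two distinct points of minimal radius `r` are adjacent: a point strictly between them would
  -- have smaller radius.
  have hadj : ∀ w w' : T.V, (∀ x ∈ X, C.sepDist w x ≤ r) → (∀ x ∈ X, C.sepDist w' x ≤ r) →
      w ≠ w' → ∃ η, T.src η = w ∧ T.tgt η = w' := by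
    intro w w' hw hw' hne
    obtain ⟨η, rfl, hη⟩ := exists_edge (C := C) hT hne
    refine ⟨η, rfl, ?_⟩
    by_contra hne'
    have hsplit := sepDist_eq_add hT hη
    have hpos := sepDist_pos (C := C) hT hne'
    have hedge := C.sepDist_edge η
    have hlt : ∀ x ∈ X, C.sepDist (T.tgt η) x + 1 ≤ r := by
      intro x hx
      have h4 := four_point (C := C) hT (T.tgt η) x (T.src η) w'
      have h1 := hw x hx
      have h2 := hw' x hx
      rw [C.sepDist_comm (T.tgt η) (T.src η), C.sepDist_comm x, C.sepDist_comm x] at h4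
      rcases le_max_iff.1 h4 with h | h <;> omega
    obtain ⟨x, hx⟩ := hX
    have h1 := hlt x hx
    exact Nat.find_min hR (m := r - 1) (by omega) ⟨T.tgt η, fun x hx => by have := hlt x hx; omega⟩
  obtain ⟨w, hw⟩ := Nat.find_spec hR
  refine ⟨w, fun g hg => ?_⟩
  have hpres : ∀ w : T.V, (∀ x ∈ X, C.sepDist w x ≤ r) → ∀ x ∈ X, C.sepDist (g • w) x ≤ r := by
    intro w hw x hx
    have := hw _ (hg x hx)
    rwa [← sepDist_smul hT g, smul_inv_smul] at this
  -- Otherwise the edge from `w` to `g • w` is inverted by `g`, or `w`, `g • w`, `g • g • w` span a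
  -- triangle. The sign function of this edge excludes both.
  by_contra hne
  have hw₁ := hpres w hw
  have hw₂ := hpres _ hw₁
  obtain ⟨η, rfl, h2⟩ := hadj w (g • w) hw hw₁ (Ne.symm hne)
  have hgs : T.src (g • η) = g • T.src η := ActsWithoutInversion.src_smul g η
  have hgη : ¬ (g • η = η ∨ g • η = T.inv η) := by
    rintro (h | h)
    · rw [h] at hgs; exact hne hgs.symm
    · exact ActsWithoutInversion.smul_ne_inv g η h
  have e1 := C.sign_tgt η η
  have e2 := C.sign_tgt η (g • η)
  rw [edgeSign_of_eq (.inl rfl)] at e1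
  rw [edgeSign_of_ne hgη, hgs, tgt_smul, h2, mul_one] at e2
  rw [h2] at e1
  by_cases hinv : g • g • T.src η = T.src η
  · rw [hinv] at e2
    rw [← e2] at e1
    exact absurd e1 (by generalize C.sign η (T.src η) = a; decide +revert)
  · obtain ⟨ζ, h3, h4⟩ := hadj _ _ hw₂ hw hinv
    have hζ : ¬ (ζ = η ∨ ζ = T.inv η) := by
      rintro (rfl | rfl)
      · exact hinv h3.symm
      · rw [show T.src (T.inv η) = T.tgt η from rfl, h2] at h3
        exact hne (MulAction.injective g h3.symm)
    have e3 := C.sign_tgt η ζ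
    rw [edgeSign_of_ne hζ, h3, h4, mul_one, e2, e1] at e3
    exact absurd e3 (by generalize C.sign η (T.src η) = a; decide +revert)

end Action

end CutSystem
end SerreGraph

/-! ### Balanced groups from acylindrical actions -/

namespace SerreGraph

variable {T : SerreGraph.{u₁, u₂}} {G : Type*} [Group G] [MulAction G T.V] [MulAction G T.E]
  [ActsWithoutInversion G T]

namespace CutSystem

variable {C : T.CutSystem} (hT : ∀ x y, T.Reachable x y)

include hT

theorem sepDist_zpow (h : G) (w : T.V) (i j : ℤ) :
    C.sepDist (h ^ i • w) (h ^ j • w) = C.sepDist w (h ^ (i - j).natAbs • w) := by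
  have key : ∀ (i : ℤ) (n : ℕ), C.sepDist (h ^ i • w) (h ^ (i + n) • w) = C.sepDist w (h ^ n • w) := by
    intro i n
    rw [zpow_add, mul_smul, sepDist_smul hT, zpow_natCast]
  rcases le_total i j with hij | hij
  · rw [← key i, show i + ((i - j).natAbs : ℤ) = j by omega]
  · rw [← key j, show j + ((i - j).natAbs : ℤ) = i by omega, C.sepDist_comm]

theorem sepDist_pow (h : G) (w : T.V) (i n : ℕ) :
    C.sepDist (h ^ i • w) (h ^ (i + n) • w) = C.sepDist w (h ^ n • w) := by
  rw [pow_add, mul_smul, sepDist_smul hT]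

/-- If the orbit does not escape at the second step, it stays bounded forever. -/
theorem sepDist_pow_le {h : G} {w : T.V} (h2 : C.sepDist w (h ^ 2 • w) ≤ C.sepDist w (h ^ 1 • w))
    (m : ℕ) : C.sepDist w (h ^ m • w) ≤ C.sepDist w (h ^ 1 • w) := by
  induction m using Nat.strong_induction_on with
  | _ m ih =>
    match m with
    | 0 => simp [sepDist_self]
    | 1 => exact le_rfl
    | m + 2 =>
      have h4 := four_point (C := C) hT w (h ^ (m + 2) • w) (h ^ 1 • w) (h ^ 2 • w)
      have e1 := sepDist_pow (C := C) hT h w 1 1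
      have e2 := sepDist_pow (C := C) hT h w 2 m
      have e3 := sepDist_pow (C := C) hT h w 1 (m + 1)
      rw [show 1 + (m + 1) = m + 2 by omega] at e3
      rw [show 2 + m = m + 2 by omega] at e2
      rw [C.sepDist_comm (h ^ (m + 2) • w), C.sepDist_comm (h ^ (m + 2) • w), e1, e2, e3] at h4
      have i1 := ih m (by omega)
      have i2 := ih (m + 1) (by omega)
      rcases le_max_iff.1 h4 with h | h <;> omega

/-- If the orbit escapes at the second step, its distance from the start increases forever. -/
theorem sepDist_pow_lt {h : G} {w : T.V} (h2 : C.sepDist w (h ^ 1 • w) < C.sepDist w (h ^ 2 • w))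
    {m : ℕ} (hm : 1 ≤ m) :
    C.sepDist w (h ^ 1 • w) ≤ C.sepDist w (h ^ m • w) ∧
      C.sepDist w (h ^ m • w) < C.sepDist w (h ^ (m + 1) • w) := by
  induction m, hm using Nat.le_induction with
  | base => exact ⟨le_rfl, h2⟩
  | succ m hm ih =>
    refine ⟨by omega, ?_⟩
    have h4 := four_point (C := C) hT w (h ^ (m + 1) • w) (h ^ 1 • w) (h ^ (m + 1 + 1) • w)
    have e1 := sepDist_pow (C := C) hT h w 1 (m + 1)
    have e2 := sepDist_pow (C := C) hT h w (m + 1) 1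
    have e3 := sepDist_pow (C := C) hT h w 1 m
    rw [show 1 + (m + 1) = m + 1 + 1 by omega] at e1
    rw [show 1 + m = m + 1 by omega] at e3
    rw [C.sepDist_comm (h ^ (m + 1) • w) (h ^ 1 • w), e1, e2, e3] at h4
    rcases le_max_iff.1 h4 with h | h <;> omega

theorem add_le_sepDist_pow {h : G} {w : T.V}
    (h2 : C.sepDist w (h ^ 1 • w) < C.sepDist w (h ^ 2 • w)) {m : ℕ} (hm : 1 ≤ m) (n : ℕ) :
    C.sepDist w (h ^ m • w) + n ≤ C.sepDist w (h ^ (m + n) • w) := by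
  induction n with
  | zero => simp
  | succ n ih =>
    have := (sepDist_pow_lt hT h2 (m := m + n) (by omega)).2
    rw [← add_assoc m]
    omega

/-- An element whose orbit of `w` does not escape at the second step is elliptic: it fixes the
centre of the orbit. -/
theorem isElliptic_of_sepDist_le {h : G} {w : T.V}
    (h2 : C.sepDist w (h ^ 2 • w) ≤ C.sepDist w (h ^ 1 • w)) : T.IsElliptic h := by
  obtain ⟨u, hu⟩ := exists_fixed_of_bounded (C := C) (G := G) hT
    (X := Set.range fun i : ℤ => h ^ i • w) ⟨_, 0, rfl⟩ (n := C.sepDist w (h ^ 1 • w)) (by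
      rintro _ ⟨i, rfl⟩ _ ⟨j, rfl⟩
      simp only [sepDist_zpow hT]
      exact sepDist_pow_le hT h2 _)
  refine ⟨u, hu h ?_⟩
  rintro _ ⟨i, rfl⟩
  refine ⟨-1 + i, ?_⟩
  simp only [zpow_add, mul_smul, zpow_neg_one]

theorem sepDist_conj_le (g a : G) (w : T.V) :
    C.sepDist w ((g * a * g⁻¹) • w) ≤ C.sepDist w (a • w) + 2 * C.sepDist w (g • w) := by
  have h1 := sepDist_triangle (C := C) hT w (g • w) ((g * a * g⁻¹) • w)
  have h2 := sepDist_triangle (C := C) hT (g • w) ((g * a) • w) ((g * a * g⁻¹) • w)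
  have h3 : C.sepDist (g • w) ((g * a) • w) = C.sepDist w (a • w) := by
    rw [mul_smul, sepDist_smul hT]
  have h4 : C.sepDist ((g * a) • w) ((g * a * g⁻¹) • w) = C.sepDist w (g • w) := by
    rw [mul_smul _ g⁻¹, sepDist_smul hT, ← sepDist_smul hT g, smul_inv_smul, C.sepDist_comm]
  omega

/-- The displacements of `h ^ (k * n)` and `h ^ (l * n)`, which are conjugate by `g`, differ by a
bounded amount; for a non-elliptic `h` this forces `|k| = |l|`. -/
theorem abs_le_abs_of_not_isElliptic (C : T.CutSystem) {g h : G} (hh : ¬ T.IsElliptic h) (w : T.V) {k l : ℤ}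
    (hk : k ≠ 0) (hgh : g * h ^ k * g⁻¹ = h ^ l) : |l| ≤ |k| := by
  by_contra! hlt
  have h2 : C.sepDist w (h ^ 1 • w) < C.sepDist w (h ^ 2 • w) := by
    by_contra! h2
    exact hh (isElliptic_of_sepDist_le hT h2)
  set n := 2 * C.sepDist w (g • w) + 1
  have h3 : g * h ^ (k * n) * g⁻¹ = h ^ (l * n) := by
    rw [zpow_mul, zpow_mul, ← hgh, ← conj_zpow]
  have h4 := sepDist_conj_le (C := C) hT g (h ^ (k * n)) w
  have h5 : ∀ i : ℤ, C.sepDist w (h ^ i • w) = C.sepDist w (h ^ i.natAbs • w) := by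
    intro i
    have := sepDist_zpow (C := C) hT h w 0 i
    rwa [zpow_zero, one_smul, zero_sub, Int.natAbs_neg] at this
  have hkl : k.natAbs < l.natAbs := by
    rwa [Int.abs_eq_natAbs, Int.abs_eq_natAbs, Nat.cast_lt] at hlt
  rw [h3, h5, h5, Int.natAbs_mul, Int.natAbs_mul, Int.natAbs_natCast] at h4
  obtain ⟨d, hd⟩ := Nat.exists_eq_add_of_lt hkl
  have h6 := add_le_sepDist_pow (C := C) hT h2 (m := k.natAbs * n)
    (Nat.mul_pos (Int.natAbs_pos.2 hk) (by omega)) ((d + 1) * n)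
  rw [← add_mul, ← add_assoc, ← hd] at h6
  have h7 : n ≤ (d + 1) * n := Nat.le_mul_of_pos_left n (by omega)
  omega

end CutSystem

theorem exists_isPath_of_edist_le {x y : T.V} {k : ℕ} (h : T.edist x y ≤ k) :
    ∃ l, T.IsPath x l y ∧ l.length ≤ k := by
  have h' : T.edist x y < (k + 1 : ℕ) := h.trans_lt (by exact_mod_cast Nat.lt_succ_self k)
  simp only [edist, iInf_lt_iff] at h'
  obtain ⟨l, hl, hlk⟩ := h'
  exact ⟨l, hl, by have := Nat.cast_lt.1 hlk; omega⟩

/-- The vertices fixed by some nontrivial power of `h`. -/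
def periodicVertices (T : SerreGraph.{u₁, u₂}) [MulAction G T.V] (h : G) : Set T.V :=
  {v | ∃ m : ℤ, m ≠ 0 ∧ h ^ m • v = v}

/-- By acylindricity, the vertices fixed by a nontrivial power of an elliptic element `h` of
infinite order form a bounded set. The inverses of `h` and of `g` map this set into itself, since
`g h ^ k g⁻¹ = h ^ l`, so `g` and `h` fix its centre. -/
theorem exists_common_fixed (C : T.CutSystem) (hT : ∀ x y, T.Reachable x y)
    (hacyl : IsSelaAcylindrical G T) {g h : G} (hh : ¬ IsOfFinOrder h) (hell : T.IsElliptic h)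
    {k l : ℤ} (hk : k ≠ 0) (hgh : g * h ^ k * g⁻¹ = h ^ l) :
    ∃ v : T.V, g • v = v ∧ h • v = v := by
  obtain ⟨K, hK⟩ := hacyl
  have hpow : ∀ m : ℤ, m ≠ 0 → h ^ m ≠ 1 := fun m hm hm' =>
    hh (isOfFinOrder_iff_zpow_eq_one.2 ⟨m, hm, hm'⟩)
  have hfix : ∀ {v : T.V} {a : G} (n : ℤ), a • v = v → a ^ n • v = v := by
    intro v a n ha
    exact (MulAction.stabilizer G v).zpow_mem ha n
  obtain ⟨u, hu⟩ := hell
  obtain ⟨v, hv⟩ := CutSystem.exists_fixed_of_bounded (C := C) (G := G) hT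
    (X := T.periodicVertices h) ⟨u, 1, one_ne_zero, by rwa [zpow_one]⟩ (n := 2 * K) (by
      rintro x ⟨m, hm, hx⟩ y ⟨n, hn, hy⟩
      have hx' : h ^ (m * n) • x = x := by rw [zpow_mul]; exact hfix n hx
      have hy' : h ^ (m * n) • y = y := by rw [mul_comm, zpow_mul]; exact hfix m hy
      have hmem : ∀ {z : T.V}, h ^ (m * n) • z = z →
          z ∈ MulAction.fixedPoints (Subgroup.zpowers (h ^ (m * n))) T.V := by
        rintro z hz ⟨_, i, rfl⟩
        exact hfix i hz
      have hd := hK (h ^ (m * n)) (hpow _ (mul_ne_zero hm hn)) ⟨x, hx'⟩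
      have hd' : T.edist x y ≤ K := by
        refine le_trans ?_ hd
        exact le_iSup₂_of_le x (hmem hx') (le_iSup₂_of_le y (hmem hy') le_rfl)
      obtain ⟨p, hp, hpK⟩ := exists_isPath_of_edist_le hd'
      have := CutSystem.sepDist_le_of_isPath (C := C) hT hp
      omega)
  refine ⟨v, hv g ?_, hv h ?_⟩
  · rintro x ⟨m, hm, hx⟩
    refine ⟨k * m, mul_ne_zero hk hm, ?_⟩
    have h1 : h ^ (k * m) = g⁻¹ * h ^ (l * m) * g := by
      rw [zpow_mul h l, ← hgh, conj_zpow, ← zpow_mul]; group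
    rw [h1, mul_smul, mul_smul, smul_inv_smul, mul_comm, zpow_mul, hfix l hx]
  · rintro x ⟨m, hm, hx⟩
    refine ⟨m, hm, ?_⟩
    rw [← mul_smul, ← zpow_neg_one, ← zpow_add, add_comm, zpow_add, mul_smul, hx]

/-- A group is balanced if it acts acylindrically, with balanced vertex stabilizers, on a connected
graph in which every edge separates. -/
theorem isBalanced_of_acylindrical (C : T.CutSystem) (hT : ∀ x y, T.Reachable x y)
    (hne : Nonempty T.V) (hacyl : IsSelaAcylindrical G T)
    (hstab : ∀ v : T.V, IsBalanced (MulAction.stabilizer G v)) : IsBalanced G := by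
  intro g h hh k l hk hl hgh
  by_cases hell : T.IsElliptic h
  · obtain ⟨v, hgv, hhv⟩ := exists_common_fixed C hT hacyl hh hell hk hgh
    refine hstab v ⟨g, hgv⟩ ⟨h, hhv⟩ ?_ k l hk hl (Subtype.ext hgh)
    rwa [← Submonoid.isOfFinOrder_coe]
  · obtain ⟨w⟩ := hne
    refine le_antisymm ?_ (CutSystem.abs_le_abs_of_not_isElliptic hT C hell w hk hgh)
    refine CutSystem.abs_le_abs_of_not_isElliptic hT C hell w (g := g⁻¹) hl ?_
    rw [← hgh]; group

end SerreGraph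

theorem IsBalanced.of_injective {A B : Type*} [Group A] [Group B] (hB : IsBalanced B)
    (F : A →* B) (hF : Function.Injective F) : IsBalanced A := by
  intro g h hh k l hk hl hgh
  refine hB (F g) (F h) ?_ k l hk hl ?_
  · rwa [hF.isOfFinOrder_iff]
  · rw [← map_zpow, ← map_zpow, ← map_inv, ← map_mul, ← map_mul, hgh]

/-! ### Vertex groups embed in the fundamental group -/

/-- Two free actions with as many orbits as points are conjugate. That there are enough orbits is expressed by a surjection `π` that is constant on orbits. -/
theorem exists_conj_of_free {A K : Type*} [Group A] {ρ₁ ρ₂ : A →* Equiv.Perm K} {π : K → K}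
    (hπ : Function.Surjective π) (h₁ : ∀ a x, π (ρ₁ a x) = π x) (h₂ : ∀ a x, π (ρ₂ a x) = π x)
    (hfree₁ : ∀ a x, ρ₁ a x = x → a = 1) (hfree₂ : ∀ a x, ρ₂ a x = x → a = 1) :
    ∃ f : Equiv.Perm K, ∀ a, f⁻¹ * ρ₁ a * f = ρ₂ a := by
  have key : ∀ ρ : A →* Equiv.Perm K, (∀ a x, π (ρ a x) = π x) → (∀ a x, ρ a x = x → a = 1) →
      ∃ θ : A × K ≃ K, ∀ a b x, θ (a * b, x) = ρ a (θ (b, x)) := by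
    intro ρ hρ hfree
    let _ : MulAction A K := MulAction.compHom K ρ
    have hsmul : ∀ (a : A) (x : K), a • x = ρ a x := fun _ _ => rfl
    let Q := MulAction.orbitRel.Quotient A K
    have hQ : ∀ x y : K, (Quotient.mk _ x : Q) = Quotient.mk _ y ↔ ∃ a : A, a • y = x := fun x y => by
      rw [Quotient.eq]; exact Iff.rfl
    -- The orbits are equinumerous with the points, and `(a, q) ↦ a • q.out` identifies the set
    -- with the product of the group and the orbit set.
    obtain ⟨j⟩ : Nonempty (K ≃ Q) := by
      refine Function.Embedding.antisymm
        ⟨fun x => Quotient.mk _ (Function.surjInv hπ x), fun x y hxy => ?_⟩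
        ⟨Quotient.out, Quotient.out_injective⟩
      obtain ⟨a, ha⟩ := (hQ _ _).1 hxy
      rw [← Function.surjInv_eq hπ x, ← ha, hsmul, hρ, Function.surjInv_eq hπ]
    refine ⟨Equiv.ofBijective (fun p => p.1 • (j p.2).out) ⟨?_, ?_⟩, ?_⟩
    · rintro ⟨a, x⟩ ⟨b, y⟩ hab
      have hab' : a • (j x).out = b • (j y).out := hab
      have hxy : j x = j y := by
        rw [← Quotient.out_eq (j x), ← Quotient.out_eq (j y)]
        exact (hQ _ _).2 ⟨a⁻¹ * b, by rw [mul_smul, ← hab', inv_smul_smul]⟩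
      obtain rfl := j.injective hxy
      have : b⁻¹ * a = 1 := hfree _ (j x).out (by rw [← hsmul, mul_smul, hab', inv_smul_smul])
      rw [inv_mul_eq_one] at this
      rw [this]
    · intro x
      obtain ⟨a, ha⟩ := (hQ x (Quotient.mk _ x : Q).out).1 (Quotient.out_eq _).symm
      exact ⟨(a, j.symm (Quotient.mk _ x)), by simpa using ha⟩
    · intro a b x
      exact mul_smul a b _
  obtain ⟨θ₁, e₁⟩ := key ρ₁ h₁ hfree₁
  obtain ⟨θ₂, e₂⟩ := key ρ₂ h₂ hfree₂
  refine ⟨θ₂.symm.trans θ₁, fun a => ?_⟩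
  ext x
  obtain ⟨⟨b, y⟩, rfl⟩ := θ₂.surjective x
  rw [← e₂, mul_assoc, Equiv.Perm.mul_apply, Equiv.Perm.inv_eq_iff_eq, Equiv.Perm.mul_apply]
  simp [← e₁]

namespace GraphOfGroups

variable {Γ : SerreGraph.{u₁, u₂}} (𝒢 : GraphOfGroups.{u₁, u₂, u₃, u₄} Γ) (T₀ : Γ.MaximalTree)

/-- Sequences in the product of all vertex groups. -/
abbrev SeqGroup : Type _ := ℕ → ∀ v, 𝒢.vertexGroup v

open Classical in
/-- The action of a vertex group on sequences by left multiplication on the zeroth term. -/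
noncomputable def seqAction (v : Γ.V) : 𝒢.vertexGroup v →* Equiv.Perm 𝒢.SeqGroup :=
  (MulAction.toPermHom 𝒢.SeqGroup 𝒢.SeqGroup).comp
    ((MonoidHom.mulSingle (fun _ : ℕ => ∀ v, 𝒢.vertexGroup v) 0).comp
      (MonoidHom.mulSingle 𝒢.vertexGroup v))

theorem seqAction_free {v : Γ.V} (x : 𝒢.vertexGroup v) (s : 𝒢.SeqGroup)
    (h : 𝒢.seqAction v x s = s) : x = 1 := by
  classical
  have h' : (Pi.mulSingle 0 (Pi.mulSingle v x) : 𝒢.SeqGroup) * s = s := h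
  simpa using h'

theorem seqAction_succ {v : Γ.V} (x : 𝒢.vertexGroup v) (s : 𝒢.SeqGroup) (n : ℕ) :
    𝒢.seqAction v x s (n + 1) = s (n + 1) := by
  classical
  have h' : 𝒢.seqAction v x s = (Pi.mulSingle 0 (Pi.mulSingle v x) : 𝒢.SeqGroup) * s := rfl
  rw [h', Pi.mul_apply, Pi.mulSingle_eq_of_ne (by omega), one_mul]

theorem edgeCast_edgeCast (e : Γ.E) (a : 𝒢.edgeGroup (Γ.unoriented e)) :
    HEq (𝒢.edgeCast (Γ.inv e) (𝒢.edgeCast e a)) a :=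
  (cast_heq _ _).trans (cast_heq _ _)

/-- `edgeCast` as an isomorphism. -/
def edgeCastEquiv (e : Γ.E) :
    𝒢.edgeGroup (Γ.unoriented e) ≃* 𝒢.edgeGroup (Γ.unoriented (Γ.inv e)) where
  toEquiv := Equiv.cast (congrArg 𝒢.edgeGroup (Γ.unoriented_inv e))
  map_mul' := by
    have : ∀ {q q' : Γ.UnorientedEdge} (h : q = q') (x y : 𝒢.edgeGroup q),
        cast (congrArg 𝒢.edgeGroup h) (x * y) =
          cast (congrArg 𝒢.edgeGroup h) x * cast (congrArg 𝒢.edgeGroup h) y := by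
      rintro q _ rfl x y; rfl
    exact this (Γ.unoriented_inv e)

theorem φ_edgeCast_edgeCast {B : Type*} [Group B] (α : ∀ v, 𝒢.vertexGroup v →* B) (e : Γ.E)
    (a : 𝒢.edgeGroup (Γ.unoriented e)) :
    α _ (𝒢.φ (Γ.inv (Γ.inv e)) (𝒢.edgeCast (Γ.inv e) (𝒢.edgeCast e a))) = α _ (𝒢.φ e a) := by
  have : ∀ (e' : Γ.E) (a' : 𝒢.edgeGroup (Γ.unoriented e')), e' = e → HEq a' a →
      α _ (𝒢.φ e' a') = α _ (𝒢.φ e a) := by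
    rintro _ _ rfl h
    rw [eq_of_heq h]
  exact this _ _ (Γ.inv_inv e) (𝒢.edgeCast_edgeCast e a)

/-- The two actions of an edge group on sequences, through its two vertex groups, are conjugate. -/
theorem exists_edgePerm (e : Γ.E) : ∃ f : Equiv.Perm 𝒢.SeqGroup, ∀ a,
    f⁻¹ * 𝒢.seqAction _ (𝒢.φ e a) * f = 𝒢.seqAction _ (𝒢.φ (Γ.inv e) (𝒢.edgeCast e a)) := by
  refine exists_conj_of_free (ρ₁ := (𝒢.seqAction _).comp (𝒢.φ e))
    (ρ₂ := ((𝒢.seqAction _).comp (𝒢.φ (Γ.inv e))).comp (𝒢.edgeCastEquiv e).toMonoidHom)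
    (π := fun s n => s (n + 1)) ?_ ?_ ?_ ?_ ?_
  -- Dropping the zeroth term is surjective and constant on orbits.
  · intro s
    exact ⟨fun n => s (n - 1), rfl⟩
  · intro a s; funext n; exact 𝒢.seqAction_succ _ s n
  · intro a s; funext n; exact 𝒢.seqAction_succ _ s n
  · intro a s h
    have := 𝒢.seqAction_free _ s h
    rwa [map_eq_one_iff _ (𝒢.φ_injective e)] at this
  · intro a s h
    have := 𝒢.seqAction_free _ s h
    rw [map_eq_one_iff _ (𝒢.φ_injective _)] at this
    exact (𝒢.edgeCastEquiv e).map_eq_one_iff.1 this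

theorem _root_.SerreGraph.eq_or_eq_inv_of_unoriented_eq {e f : Γ.E}
    (h : Γ.unoriented e = Γ.unoriented f) : e = f ∨ e = Γ.inv f := by
  let S : Γ.UnorientedEdge → Set Γ.E := Quot.lift (fun e => {e, Γ.inv e}) (by
    rintro e _ rfl
    rw [Γ.inv_inv, Set.pair_comm])
  have hS : S (Γ.unoriented e) = S (Γ.unoriented f) := congrArg S h
  exact (hS ▸ Set.mem_insert e _ : e ∈ S (Γ.unoriented f))

/-- Permutations that intertwine the actions of the edge groups, chosen on one orientation of each
edge and inverted on the other. -/
noncomputable def seqPreHom : 𝒢.PreHom (Equiv.Perm 𝒢.SeqGroup) :=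
  open Classical in
  let f₀ (e : Γ.E) := (𝒢.exists_edgePerm e).choose
  let pos (e : Γ.E) : Prop := (Quot.out (Γ.unoriented e) : Γ.E) = e
  have hpos (e : Γ.E) : pos (Γ.inv e) ↔ ¬ pos e := by
    have h1 := Γ.eq_or_eq_inv_of_unoriented_eq (Quot.out_eq (Γ.unoriented e))
    have h2 := Γ.inv_ne e
    simp only [pos, ← Γ.unoriented_inv]
    grind
  { α := 𝒢.seqAction
    f := fun e => if pos e then f₀ e else (f₀ (Γ.inv e))⁻¹
    f_inv := by
      intro e
      by_cases h : pos e
      · rw [if_pos h, if_neg ((hpos e).not.2 (not_not.2 h)), Γ.inv_inv]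
      · rw [if_neg h, if_pos ((hpos e).2 h), inv_inv]
    conj := by
      intro e a
      by_cases h : pos e
      · rw [if_pos h]
        exact (𝒢.exists_edgePerm e).choose_spec a
      · rw [if_neg h]
        have := (𝒢.exists_edgePerm (Γ.inv e)).choose_spec (𝒢.edgeCast e a)
        rw [𝒢.φ_edgeCast_edgeCast 𝒢.seqAction] at this
        rw [← this]
        change _ * ((f₀ (Γ.inv e))⁻¹ * _ * f₀ (Γ.inv e)) * _ = _
        group }

theorem ofVertex_injective (v : Γ.V) : Function.Injective (𝒢.ofVertex T₀ v) := by
  rw [injective_iff_map_eq_one]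
  intro x hx
  have h := 𝒢.seqPreHom.lift_ofVertex T₀ v x
  rw [hx, map_one, eq_comm, mul_inv_eq_one, mul_eq_left] at h
  refine 𝒢.seqAction_free x 1 ?_
  change 𝒢.seqPreHom.α v x 1 = 1
  rw [h]; rfl

end GraphOfGroups

/-! ### The Bass–Serre graph is connected and all its edges separate -/

namespace GraphOfGroups

variable {Γ : SerreGraph.{u₁, u₂}} (𝒢 : GraphOfGroups.{u₁, u₂, u₃, u₄} Γ) (T₀ : Γ.MaximalTree)

/-- The vertex `g G_v` of the Bass–Serre tree. -/
def cosetVertex (g : 𝒢.FundamentalGroup T₀) (v : Γ.V) : (𝒢.bassSerreTree T₀).V :=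
  ⟨v, QuotientGroup.mk g⟩

/-- The edge `g φ_e(G_e)` of the Bass–Serre tree. -/
def cosetEdge (g : 𝒢.FundamentalGroup T₀) (e : Γ.E) : (𝒢.bassSerreTree T₀).E :=
  ⟨e, QuotientGroup.mk g⟩

theorem src_cosetEdge (g : 𝒢.FundamentalGroup T₀) (e : Γ.E) :
    (𝒢.bassSerreTree T₀).src (𝒢.cosetEdge T₀ g e) = 𝒢.cosetVertex T₀ g (Γ.src e) := rfl

theorem inv_cosetEdge (g : 𝒢.FundamentalGroup T₀) (e : Γ.E) :
    (𝒢.bassSerreTree T₀).inv (𝒢.cosetEdge T₀ g e) =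
      𝒢.cosetEdge T₀ (g * 𝒢.stableLetter T₀ e) (Γ.inv e) := rfl

theorem tgt_cosetEdge (g : 𝒢.FundamentalGroup T₀) (e : Γ.E) :
    (𝒢.bassSerreTree T₀).tgt (𝒢.cosetEdge T₀ g e) =
      𝒢.cosetVertex T₀ (g * 𝒢.stableLetter T₀ e) (Γ.tgt e) := rfl

theorem smul_cosetVertex (g g' : 𝒢.FundamentalGroup T₀) (v : Γ.V) :
    g • 𝒢.cosetVertex T₀ g' v = 𝒢.cosetVertex T₀ (g * g') v := rfl

theorem smul_cosetEdge (g g' : 𝒢.FundamentalGroup T₀) (e : Γ.E) :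
    g • 𝒢.cosetEdge T₀ g' e = 𝒢.cosetEdge T₀ (g * g') e := rfl

theorem exists_cosetVertex (x : (𝒢.bassSerreTree T₀).V) : ∃ g v, x = 𝒢.cosetVertex T₀ g v := by
  obtain ⟨v, x⟩ := x
  obtain ⟨g, rfl⟩ := QuotientGroup.mk_surjective x
  exact ⟨g, v, rfl⟩

theorem exists_cosetEdge (x : (𝒢.bassSerreTree T₀).E) : ∃ g e, x = 𝒢.cosetEdge T₀ g e := by
  obtain ⟨v, x⟩ := x
  obtain ⟨g, rfl⟩ := QuotientGroup.mk_surjective x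
  exact ⟨g, v, rfl⟩

theorem cosetVertex_eq_iff {g g' : 𝒢.FundamentalGroup T₀} {v : Γ.V} :
    𝒢.cosetVertex T₀ g v = 𝒢.cosetVertex T₀ g' v ↔ ∃ x, 𝒢.ofVertex T₀ v x = g⁻¹ * g' := by
  refine Iff.trans ⟨fun h => eq_of_heq (Sigma.mk.inj h).2, fun h => congrArg (Sigma.mk v) h⟩ ?_
  exact QuotientGroup.eq

theorem cosetVertex_mul_ofVertex (g : 𝒢.FundamentalGroup T₀) {v : Γ.V} (x : 𝒢.vertexGroup v) :
    𝒢.cosetVertex T₀ (g * 𝒢.ofVertex T₀ v x) v = 𝒢.cosetVertex T₀ g v :=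
  (𝒢.cosetVertex_eq_iff T₀).2 ⟨x⁻¹, by rw [map_inv]; group⟩

theorem smul_cosetEdge_φ (e : Γ.E) (a : 𝒢.edgeGroup (Γ.unoriented e)) :
    𝒢.ofVertex T₀ _ (𝒢.φ e a) • 𝒢.cosetEdge T₀ 1 e = 𝒢.cosetEdge T₀ 1 e := by
  rw [smul_cosetEdge, mul_one]
  refine congrArg (Sigma.mk e) (QuotientGroup.eq.2 ⟨a⁻¹, ?_⟩)
  rw [map_inv, mul_one]; rfl

theorem stableLetter_of_mem {e : Γ.E} (he : e ∈ T₀.edges) : 𝒢.stableLetter T₀ e = 1 :=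
  𝒢.toFundamentalGroup_relator T₀ (.tree e he)

/-- The maximal tree lifts to the Bass–Serre tree. -/
theorem reachable_cosetVertex_one (v w : Γ.V) :
    (𝒢.bassSerreTree T₀).Reachable (𝒢.cosetVertex T₀ 1 v) (𝒢.cosetVertex T₀ 1 w) := by
  obtain ⟨l, hl⟩ := T₀.isTree.connected v w
  change T₀.graph.IsPath v l w at hl
  induction l generalizing v with
  | nil => obtain rfl : v = w := hl; exact .refl
  | cons e l ih =>
    obtain ⟨rfl, hl⟩ := hl
    refine .trans ?_ (ih _ hl)
    have h := SerreGraph.Reachable.edge (𝒢.cosetEdge T₀ 1 (T₀.incl e))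
    rw [src_cosetEdge, tgt_cosetEdge, 𝒢.stableLetter_of_mem T₀ (T₀.incl_mem e), mul_one] at h
    exact h

theorem reachable_bassSerreTree (x y : (𝒢.bassSerreTree T₀).V) :
    (𝒢.bassSerreTree T₀).Reachable x y := by
  let b := 𝒢.cosetVertex T₀ 1 T₀.isTree.nonempty.some
  -- The elements that move the base vertex within its component form a subgroup.
  let S : Subgroup (𝒢.FundamentalGroup T₀) :=
    { carrier := {g | (𝒢.bassSerreTree T₀).Reachable b (g • b)}
      one_mem' := by
        change SerreGraph.Reachable _ b ((1 : 𝒢.FundamentalGroup T₀) • b)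
        rw [one_smul]; exact .refl
      mul_mem' := by
        intro g g' hg hg'
        change SerreGraph.Reachable _ b ((g * g') • b)
        rw [mul_smul]
        exact .trans hg (SerreGraph.Reachable.smul g hg')
      inv_mem' := by
        intro g hg
        change SerreGraph.Reachable _ b (g⁻¹ • b)
        have := (SerreGraph.Reachable.smul g⁻¹ hg).symm
        rwa [inv_smul_smul] at this }
  have hS : S = ⊤ := by
    refine 𝒢.subgroup_eq_top T₀ S (fun v x => ?_) fun e => ?_
    · have h1 := 𝒢.reachable_cosetVertex_one T₀ T₀.isTree.nonempty.some v
      have h2 := h1.symm.smul (𝒢.ofVertex T₀ v x)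
      have h3 := 𝒢.cosetVertex_mul_ofVertex T₀ 1 x
      rw [smul_cosetVertex, mul_one, ← one_mul (𝒢.ofVertex T₀ v x), h3, one_mul] at h2
      exact .trans h1 h2
    · have h1 := 𝒢.reachable_cosetVertex_one T₀ T₀.isTree.nonempty.some (Γ.src e)
      have h2 := SerreGraph.Reachable.edge (𝒢.cosetEdge T₀ 1 e)
      have h3 := (𝒢.reachable_cosetVertex_one T₀ (Γ.tgt e) T₀.isTree.nonempty.some).smul
        (𝒢.stableLetter T₀ e)
      rw [src_cosetEdge, tgt_cosetEdge, one_mul] at h2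
      rw [smul_cosetVertex, mul_one] at h3
      exact (h1.trans h2).trans h3
  have key : ∀ x, (𝒢.bassSerreTree T₀).Reachable b x := by
    intro x
    obtain ⟨g, v, rfl⟩ := 𝒢.exists_cosetVertex T₀ x
    have hg : g ∈ S := hS ▸ Subgroup.mem_top g
    have h := (𝒢.reachable_cosetVertex_one T₀ T₀.isTree.nonempty.some v).smul g
    rw [smul_cosetVertex _ _ g 1 v, mul_one] at h
    exact .trans hg h
  exact (key x).symm.trans (key y)

/-- Sign functions on the edges of the Bass–Serre tree, extended by the fundamental group. -/
abbrev SignGroup : Type _ :=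
  ((𝒢.bassSerreTree T₀).E → ℤˣ) ⋊[mulAutArrow] 𝒢.FundamentalGroup T₀

/-- The label of an edge `e` records that passing along the edge `φ_e(G_e)` of the Bass–Serre
tree changes the side of this edge only. -/
noncomputable def signPreHom : 𝒢.PreHom (𝒢.SignGroup T₀) where
  α v := SemidirectProduct.inr.comp (𝒢.ofVertex T₀ v)
  f e := ⟨fun ε => SerreGraph.edgeSign ε (𝒢.cosetEdge T₀ 1 e), 𝒢.stableLetter T₀ e⟩
  f_inv e := by
    rw [eq_comm, inv_eq_iff_mul_eq_one]
    refine SemidirectProduct.ext ?_ (𝒢.stableLetter_mul_inv T₀ e)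
    funext ε
    change SerreGraph.edgeSign ε (𝒢.cosetEdge T₀ 1 e) *
      SerreGraph.edgeSign ((𝒢.stableLetter T₀ e)⁻¹ • ε) (𝒢.cosetEdge T₀ 1 (Γ.inv e)) = 1
    rw [SerreGraph.edgeSign_inv_smul, smul_cosetEdge, mul_one,
      ← SerreGraph.edgeSign_inv ε (𝒢.cosetEdge T₀ 1 e), inv_cosetEdge, one_mul, Int.units_mul_self]
  conj e a := by
    rw [mul_assoc, inv_mul_eq_iff_eq_mul]
    refine SemidirectProduct.ext ?_ ?_
    · funext ε
      change 1 * SerreGraph.edgeSign ((𝒢.ofVertex T₀ _ (𝒢.φ e a))⁻¹ • ε) (𝒢.cosetEdge T₀ 1 e) =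
        SerreGraph.edgeSign ε (𝒢.cosetEdge T₀ 1 e) * 1
      rw [SerreGraph.edgeSign_inv_smul, smul_cosetEdge_φ, one_mul, mul_one]
    · have := 𝒢.stableLetter_conj T₀ e a
      rw [mul_assoc, inv_mul_eq_iff_eq_mul] at this
      exact this

/-- The stable letters of the maximal tree are trivial, so potentials have only a sign component. -/
theorem right_potential (v : Γ.V) :
    (T₀.potential (𝒢.signPreHom T₀).f v).right = 1 := by
  have := T₀.map_potential SemidirectProduct.rightHom (𝒢.signPreHom T₀).f v
  rw [SemidirectProduct.rightHom_eq_right] at this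
  rw [this]
  exact T₀.potential_eq_one (fun e he => 𝒢.stableLetter_of_mem T₀ he) v

theorem right_lift (g : 𝒢.FundamentalGroup T₀) : ((𝒢.signPreHom T₀).lift T₀ g).right = g := by
  have : SemidirectProduct.rightHom.comp ((𝒢.signPreHom T₀).lift T₀) = MonoidHom.id _ := by
    refine 𝒢.fundamentalGroup_hom_ext T₀ (fun v x => ?_) fun e => ?_
    · rw [MonoidHom.comp_apply, PreHom.lift_ofVertex, SemidirectProduct.rightHom_eq_right]
      simp only [SemidirectProduct.mul_right, SemidirectProduct.inv_right, right_potential]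
      simp [signPreHom]
    · rw [MonoidHom.comp_apply, PreHom.lift_stableLetter, SemidirectProduct.rightHom_eq_right]
      simp only [SemidirectProduct.mul_right, SemidirectProduct.inv_right, right_potential]
      simp [signPreHom]
  exact DFunLike.congr_fun this g

/-- The sign at `g G_v` is the sign component of the image of `g`, multiplied by the potential
of `v`, under the homomorphism induced by `signPreHom`. -/
noncomputable def cosetSign (ε : (𝒢.bassSerreTree T₀).E) (v : Γ.V) :
    𝒢.FundamentalGroup T₀ ⧸ 𝒢.vertexSubgroup T₀ v → ℤˣ :=
  Quotient.lift
    (fun g => ((𝒢.signPreHom T₀).lift T₀ g * T₀.potential (𝒢.signPreHom T₀).f v).left ε) (by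
      intro g g' h
      obtain ⟨y, hy⟩ := QuotientGroup.leftRel_apply.1 h
      obtain rfl : g' = g * 𝒢.ofVertex T₀ _ y := by rw [hy]; group
      rw [map_mul, PreHom.lift_ofVertex, mul_assoc _ _ (T₀.potential _ _), inv_mul_cancel_right,
        ← mul_assoc, SemidirectProduct.mul_left _ ((𝒢.signPreHom T₀).α _ _)]
      simp [signPreHom])

/-- The cuts of the Bass–Serre tree. -/
noncomputable def cutSystem : (𝒢.bassSerreTree T₀).CutSystem where
  sign ε x := 𝒢.cosetSign T₀ ε x.1 x.2
  sign_tgt ε η := by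
    obtain ⟨g, e, rfl⟩ := 𝒢.exists_cosetEdge T₀ η
    change ((𝒢.signPreHom T₀).lift T₀ (g * 𝒢.stableLetter T₀ e) *
        T₀.potential (𝒢.signPreHom T₀).f (Γ.tgt e)).left ε =
      ((𝒢.signPreHom T₀).lift T₀ g * T₀.potential (𝒢.signPreHom T₀).f (Γ.src e)).left ε * _
    rw [map_mul, PreHom.lift_stableLetter, mul_assoc _ _ (T₀.potential _ (Γ.tgt e)),
      inv_mul_cancel_right, ← mul_assoc, SemidirectProduct.mul_left _ ((𝒢.signPreHom T₀).f e),
      SemidirectProduct.mul_right, right_lift, right_potential, mul_one, Pi.mul_apply]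
    congr 1
    change SerreGraph.edgeSign (g⁻¹ • ε) (𝒢.cosetEdge T₀ 1 e) = _
    rw [SerreGraph.edgeSign_inv_smul, smul_cosetEdge, mul_one]

/-! ### Balancedness of the fundamental group -/

theorem isBalanced_stabilizer (hbal : ∀ v : Γ.V, IsBalanced (𝒢.vertexGroup v))
    (x : (𝒢.bassSerreTree T₀).V) :
    IsBalanced (MulAction.stabilizer (𝒢.FundamentalGroup T₀) x) := by
  obtain ⟨γ, v, rfl⟩ := 𝒢.exists_cosetVertex T₀ x
  -- The stabilizer of `γ G_v` is `γ G_v γ⁻¹`, which is isomorphic to the vertex group.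
  let ψ : 𝒢.vertexGroup v ≃* (𝒢.ofVertex T₀ v).range :=
    MonoidHom.ofInjective (𝒢.ofVertex_injective T₀ v)
  let c : MulAction.stabilizer (𝒢.FundamentalGroup T₀) (𝒢.cosetVertex T₀ γ v) →*
      (𝒢.ofVertex T₀ v).range :=
    ((MulAut.conj γ⁻¹).toMonoidHom.comp (Subgroup.subtype _)).codRestrict _ (by
      rintro ⟨g, hg⟩
      rw [MulAction.mem_stabilizer_iff, smul_cosetVertex, eq_comm, cosetVertex_eq_iff] at hg
      obtain ⟨y, hy⟩ := hg
      refine ⟨y, ?_⟩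
      rw [hy]
      simp [mul_assoc])
  refine (hbal v).of_injective (ψ.symm.toMonoidHom.comp c) (ψ.symm.injective.comp ?_)
  intro a b hab
  have h := congrArg Subtype.val hab
  exact Subtype.ext ((MulAut.conj γ⁻¹).injective h)

end GraphOfGroups

theorem mainTheorem4 {Γ : SerreGraph.{u₁, u₂}} (𝒢 : GraphOfGroups.{u₁, u₂, u₃, u₄} Γ)
    (T₀ : Γ.MaximalTree)
    (hbal : ∀ v : Γ.V, IsBalanced (𝒢.vertexGroup v))
    (hacyl : SerreGraph.IsSelaAcylindrical (𝒢.FundamentalGroup T₀) (𝒢.bassSerreTree T₀)) :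
    IsBalanced (𝒢.FundamentalGroup T₀) :=
  SerreGraph.isBalanced_of_acylindrical (𝒢.cutSystem T₀) (𝒢.reachable_bassSerreTree T₀)
    ⟨𝒢.cosetVertex T₀ 1 T₀.isTree.nonempty.some⟩ hacyl (𝒢.isBalanced_stabilizer T₀ hbal)
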